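/- Let $\mathbb N=\{0,1,2,\ldots\}$. (i) Every integer $n\ge 1$ can be written as $n=x^2+y^2+z^2+w^2$ with $x,y,z,w\in\mathbb N$ and $|x+y-z|\in\{4^k: k\in\mathbb N\}$. (ii) Let $a\in\{1,2\}$. Then every $n\in\mathbb N$ can be written as $n=x^2+y^2+z^2+w^2$ with $x,y,z,w\in\mathbb N$ and $x+y-z\in\{\pm a\,8^k: k\in\mathbb N\}\cup\{0\}$. Moreover, $\{\pm a\,8^k: k\in\mathbb N\}\cup\{0\}\subseteq\{a t^3: t\in\mathbb Z\}$. -/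

import Mathlib

/-! If 3n - m² = A² + B² + C², then x, y, z, w = (m+A-B)/3, (m+B-C)/3, (m+C-A)/3, (A+B+C)/3 satisfy
x+y+z = m and have squares summing to n. For m = 0 or 3 ∤ m, signs and order of A, B, C can be
chosen to make these integral; for n large against m², also xy+yz+zx ≤ 0. The signs of x, y, z are
then mixed enough to give x+y-z = ±m in ℕ. It remains to find an allowed m for which 3n - m² is a
sum of three squares. Scaling by 4 in (i) and by 8 in (ii) leaves few residue classes of n; the
three-square theorem, proved by reducing ternary forms and Dirichlet's theorem on primes, settles
them up to small n. -/

/-! ### Reduction of unimodular ternary forms -/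

/-- The ternary form `a x² + b y² + c z² + 2 r y z + 2 s x z + 2 t x y` is positive definite of
determinant one and represents `N`. -/
def UnimodularTernaryRep (N a b c r s t : ℤ) : Prop :=
  0 < a ∧ 0 < a * b - t ^ 2 ∧
    a * b * c + 2 * r * s * t - a * r ^ 2 - b * s ^ 2 - c * t ^ 2 = 1 ∧
    ∃ x y z : ℤ, N = a * x ^ 2 + b * y ^ 2 + c * z ^ 2 + 2 * r * y * z + 2 * s * x * z +
      2 * t * x * y

namespace UnimodularTernaryRep

variable {N a b c r s t : ℤ}

theorem swap_left (h : UnimodularTernaryRep N a b c r s t) :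
    UnimodularTernaryRep N b a c s r t := by
  obtain ⟨h1, h2, h3, x, y, z, h4⟩ := h
  refine ⟨?_, by linarith, by linarith, y, x, z, by linarith⟩
  by_contra hb
  nlinarith [sq_nonneg t]

theorem minor_identity (h : UnimodularTernaryRep N a b c r s t) :
    (a * b - t ^ 2) * (a * c - s ^ 2) = a + (a * r - s * t) ^ 2 := by
  linear_combination a * h.2.2.1

theorem swap_right (h : UnimodularTernaryRep N a b c r s t) :
    UnimodularTernaryRep N a c b r t s := by
  have hm := h.minor_identity
  obtain ⟨h1, h2, h3, x, y, z, h4⟩ := h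
  refine ⟨h1, ?_, by linarith, x, z, y, by linarith⟩
  by_contra hb
  nlinarith [sq_nonneg (a * r - s * t)]

theorem shear_right (h : UnimodularTernaryRep N a b c r s t) (k : ℤ) :
    UnimodularTernaryRep N a b (c + 2 * k * r + k ^ 2 * b) (r + k * b) (s + k * t) t := by
  obtain ⟨h1, h2, h3, x, y, z, h4⟩ := h
  exact ⟨h1, h2, by linear_combination h3, x, y - k * z, z, by linear_combination h4⟩

theorem shear_left (h : UnimodularTernaryRep N a b c r s t) (k : ℤ) :
    UnimodularTernaryRep N a (b + 2 * k * t + k ^ 2 * a) c (r + k * s) s (t + k * a) := by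
  obtain ⟨h1, h2, h3, x, y, z, h4⟩ := h
  exact ⟨h1, by linarith, by linear_combination h3, x - k * y, y, z, by linear_combination h4⟩

end UnimodularTernaryRep

theorem Int.exists_abs_two_mul_add_mul_le (t : ℤ) {a : ℤ} (ha : 0 < a) :
    ∃ k : ℤ, |2 * (t + k * a)| ≤ a := by
  refine ⟨-((2 * t + a) / (2 * a)), ?_⟩
  have h1 := Int.emod_add_mul_ediv (2 * t + a) (2 * a)
  have h2 := Int.emod_nonneg (2 * t + a) (by omega : 2 * a ≠ 0)
  have h3 := Int.emod_lt_of_pos (2 * t + a) (by omega : 0 < 2 * a)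
  rw [abs_le]
  constructor <;> linarith

/-- Take an equivalent form with (a, D) lexicographically least, D = ab - t². Shears shift ar - st
by multiples of D and t by multiples of a; the swaps give a ≤ b and D ≤ ac - s². Hence 3D² ≤ 4a and
3a² ≤ 4D, so a = D = 1. -/
theorem UnimodularTernaryRep.sum_three_squares {N a b c r s t : ℤ}
    (h : UnimodularTernaryRep N a b c r s t) : ∃ x y z : ℤ, N = x ^ 2 + y ^ 2 + z ^ 2 := by
  obtain ⟨⟨A, D⟩, ⟨b₀, c₀, r₀, s₀, t₀, h₀, hD₀⟩, hmin⟩ :=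
    (wellFounded_lt (α := ℕ ×ₗ ℕ)).has_min
      {q : ℕ ×ₗ ℕ | ∃ b c r s t : ℤ, UnimodularTernaryRep N ((ofLex q).1 : ℤ) b c r s t ∧
        ((ofLex q).2 : ℤ) = ((ofLex q).1 : ℤ) * b - t ^ 2}
      ⟨toLex (a.toNat, (a * b - t ^ 2).toNat), b, c, r, s, t, by
        simpa [Int.toNat_of_nonneg h.1.le, Int.toNat_of_nonneg h.2.1.le] using h⟩
  change UnimodularTernaryRep N (A : ℤ) b₀ c₀ r₀ s₀ t₀ at h₀
  change (D : ℤ) = (A : ℤ) * b₀ - t₀ ^ 2 at hD₀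
  have hmin' : ∀ a b c r s t : ℤ, UnimodularTernaryRep N a b c r s t →
      (A : ℤ) < a ∨ (A : ℤ) = a ∧ (D : ℤ) ≤ a * b - t ^ 2 := by
    intro a b c r s t h
    have := hmin (toLex (a.toNat, (a * b - t ^ 2).toNat)) ⟨b, c, r, s, t, by
        simpa [Int.toNat_of_nonneg h.1.le, Int.toNat_of_nonneg h.2.1.le] using h⟩
    change ¬ (toLex (a.toNat, (a * b - t ^ 2).toNat) < toLex (A, D)) at this
    rw [Prod.Lex.toLex_lt_toLex] at this
    have h1 := h.1
    have h2 := h.2.1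
    simp only at this
    omega
  clear hmin
  obtain ⟨k, hk⟩ := Int.exists_abs_two_mul_add_mul_le (A * r₀ - s₀ * t₀) (hD₀ ▸ h₀.2.1)
  obtain ⟨l, hl⟩ := Int.exists_abs_two_mul_add_mul_le t₀ h₀.1
  have h₁ := (h₀.shear_right k).shear_left l
  have hE : |2 * (A * (r₀ + k * b₀ + l * (s₀ + k * t₀)) - (s₀ + k * t₀) * (t₀ + l * A))| ≤
      (D : ℤ) := by
    convert hk using 3
    rw [hD₀]; ring
  have hD₁ : (D : ℤ) = A * (b₀ + 2 * l * t₀ + l ^ 2 * A) - (t₀ + l * A) ^ 2 := by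
    rw [hD₀]; ring
  generalize b₀ + 2 * l * t₀ + l ^ 2 * (A : ℤ) = b₁ at *
  generalize c₀ + 2 * k * r₀ + k ^ 2 * b₀ = c₁ at *
  generalize r₀ + k * b₀ + l * (s₀ + k * t₀) = r₁ at *
  generalize s₀ + k * t₀ = s₁ at *
  generalize t₀ + l * (A : ℤ) = t₁ at *
  have hA : (0 : ℤ) < A := h₁.1
  have hD : (0 : ℤ) < D := hD₁ ▸ h₁.2.1
  have hm := h₁.minor_identity
  rw [← hD₁] at hm
  have hb : (A : ℤ) ≤ b₁ := by
    rcases hmin' _ _ _ _ _ _ h₁.swap_left with h | h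
    · exact h.le
    · exact h.1.le
  have hF : (D : ℤ) ≤ A * c₁ - s₁ ^ 2 := by
    rcases hmin' _ _ _ _ _ _ h₁.swap_right with h | h
    · exact absurd h (lt_irrefl _)
    · exact h.2
  have h3 : 3 * (D : ℤ) ^ 2 ≤ 4 * A := by
    have := sq_le_sq' (neg_le_of_abs_le hE) (le_of_abs_le hE)
    nlinarith
  have h4 : 3 * (A : ℤ) ^ 2 ≤ 4 * D := by
    have := sq_le_sq' (neg_le_of_abs_le hl) (le_of_abs_le hl)
    nlinarith
  have hA1 : (A : ℤ) = 1 := by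
    by_contra hne
    have : (2 : ℤ) ≤ A := by omega
    nlinarith
  have hD1 : (D : ℤ) = 1 := by
    by_contra hne
    have : (2 : ℤ) ≤ D := by omega
    nlinarith
  rw [hA1] at hl hE hD₁ hm h₁
  rw [hD1] at hE hD₁ hm
  have ht : t₁ = 0 := by rw [abs_le] at hl; omega
  subst ht
  have hr : r₁ = 0 := by
    rw [abs_le] at hE; omega
  subst hr
  obtain ⟨-, -, -, x, y, z, hN⟩ := h₁
  refine ⟨x + s₁ * z, y, z, ?_⟩
  linear_combination hN - y ^ 2 * hD₁ + z ^ 2 * hm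

/-! ### The three-square theorem -/

theorem exists_sum_three_squares_of_dvd {N d t : ℤ} (hN : 2 ≤ N) (hd : 0 < d)
    (h : d * N - 1 ∣ t ^ 2 + d) : ∃ x y z : ℤ, N = x ^ 2 + y ^ 2 + z ^ 2 := by
  obtain ⟨a, ha⟩ := h
  have hb : 0 < d * N - 1 := by nlinarith
  have ha0 : 0 < a := by
    by_contra hneg
    nlinarith [sq_nonneg t]
  -- The leading minor is d and the determinant is dN - (dN - 1) = 1.
  refine UnimodularTernaryRep.sum_three_squares (a := a) (b := d * N - 1) (c := N) (r := 0)
    (s := 1) (t := t) ⟨ha0, ?_, ?_, 0, 0, 1, by ring⟩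
  · linarith
  · linear_combination (-N) * ha

theorem exists_dvd_sq_add_of_jacobiSym {p : ℕ} (hp : p.Prime) {d : ℤ}
    (h : jacobiSym (-d) p = 1) : ∃ t : ℤ, (p : ℤ) ∣ t ^ 2 + d := by
  have := Fact.mk hp
  rw [← jacobiSym.legendreSym.to_jacobiSym] at h
  have hne : ((-d : ℤ) : ZMod p) ≠ 0 := by
    intro h0
    rw [(legendreSym.eq_zero_iff p (-d)).2 h0] at h
    exact zero_ne_one h
  obtain ⟨u, hu⟩ := (legendreSym.eq_one_iff p hne).1 h
  obtain ⟨t, rfl⟩ := ZMod.intCast_surjective u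
  refine ⟨t, (ZMod.intCast_zmod_eq_zero_iff_dvd _ p).1 ?_⟩
  push_cast at hu ⊢
  linear_combination -hu

theorem exists_prime_eq_mul_add {N u : ℕ} (hN : 0 < N) (hu : Odd u) (huN : u.Coprime N) :
    ∃ j p : ℕ, p.Prime ∧ p = 4 * N * j + u := by
  have hcop : u.Coprime (4 * N) := by
    refine Nat.Coprime.mul_right ?_ huN
    exact (Nat.coprime_pow_right_iff (n := 2) (by norm_num) u 2).2 (Nat.coprime_two_right.2 hu)
  obtain ⟨p, hpu, hp, hmod⟩ := Nat.forall_exists_prime_gt_and_modEq u (by positivity) hcop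
  obtain ⟨j, hj⟩ := (Nat.modEq_iff_dvd' hpu.le).1 hmod.symm
  exact ⟨j, p, hp, by omega⟩

theorem exists_sum_three_squares_of_mod_four_eq_two {N : ℕ} (hN : N % 4 = 2) :
    ∃ x y z : ℤ, (N : ℤ) = x ^ 2 + y ^ 2 + z ^ 2 := by
  obtain ⟨j, p, hp, hpj⟩ := exists_prime_eq_mul_add (N := N) (u := N - 1) (by omega)
    (Nat.odd_iff.2 (by omega))
    (by simpa using (Nat.coprime_self_sub_left (m := 1) (n := N) (by omega)).2 (by simp))
  have hp4 : p % 4 = 1 := by rw [hpj, mul_assoc]; omega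
  have hpd : (p : ℤ) = (4 * j + 1 : ℕ) * N - 1 := by
    rw [hpj, Nat.cast_add, Nat.cast_sub (by omega)]
    push_cast; ring
  have hJ : jacobiSym (-((4 * j + 1 : ℕ) : ℤ)) p = 1 := by
    have hodd : Odd (4 * j + 1) := Nat.odd_iff.2 (by omega)
    rw [jacobiSym.neg _ (Nat.odd_iff.2 (by omega)), ZMod.χ₄_nat_one_mod_four hp4, one_mul,
      jacobiSym.quadratic_reciprocity_one_mod_four (by omega) (Nat.odd_iff.2 (by omega)),
      jacobiSym.mod_left' (a₂ := -1) (b := 4 * j + 1), jacobiSym.at_neg_one hodd,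
      ZMod.χ₄_nat_one_mod_four (by omega)]
    exact (Int.modEq_iff_dvd).2 ⟨-N, by rw [hpd]; ring⟩
  obtain ⟨t, ht⟩ := exists_dvd_sq_add_of_jacobiSym hp hJ
  exact exists_sum_three_squares_of_dvd (by omega) (by positivity) (hpd ▸ ht)

/-- Dirichlet gives a prime p with 2p = dN - 1 and d ≡ c mod 8. As (-2/d) = 1, also (p/d) = 1; `hc`
excludes p ≡ 3, d ≡ 1 mod 4, so reciprocity yields (-d/p) = 1. -/
theorem exists_sum_three_squares_of_odd {N c u : ℕ} (hN : 2 ≤ N) (huN : 2 * u + 1 = c * N)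
    (hc : c % 8 = 1 ∧ u % 4 = 1 ∨ c % 8 = 3 ∧ u % 2 = 1) :
    ∃ x y z : ℤ, (N : ℤ) = x ^ 2 + y ^ 2 + z ^ 2 := by
  have hcop : u.Coprime N := by
    have h1 : u.Coprime (c * N) := by rw [← huN]; simp
    exact h1.coprime_mul_left_right
  obtain ⟨j, p, hp, hpj⟩ := exists_prime_eq_mul_add (N := N) (by omega)
    (Nat.odd_iff.2 (by omega)) hcop
  have hpu : p % 4 = u % 4 := by rw [hpj, mul_assoc]; omega
  obtain ⟨d, hd⟩ : ∃ d, d = 8 * j + c := ⟨_, rfl⟩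
  have hpd : 2 * (p : ℤ) = d * N - 1 := by
    have h1 : (2 * u + 1 : ℤ) = c * N := by exact_mod_cast huN
    rw [hpj, hd]
    push_cast
    linear_combination h1
  have hdodd : Odd d := Nat.odd_iff.2 (by omega)
  have hpodd : Odd p := Nat.odd_iff.2 (by omega)
  have hJp : jacobiSym p d = 1 := by
    have h2 : jacobiSym (-2) d = 1 := by
      rw [jacobiSym.at_neg_two hdodd, ZMod.χ₈'_nat_eq_if_mod_eight, if_neg (by omega),
        if_pos (by omega)]
    have h1 : jacobiSym (-2 * p) d = 1 := by
      rw [jacobiSym.mod_left' (a₂ := 1), jacobiSym.one_left]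
      exact (Int.modEq_iff_dvd).2 ⟨N, by linear_combination hpd⟩
    rwa [jacobiSym.mul_left, h2, one_mul] at h1
  have hJ : jacobiSym (-(d : ℤ)) p = 1 := by
    rw [jacobiSym.neg _ hpodd]
    by_cases hp4 : p % 4 = 1
    · rw [ZMod.χ₄_nat_one_mod_four hp4, one_mul,
        ← jacobiSym.quadratic_reciprocity_one_mod_four hp4 hdodd, hJp]
    · rw [ZMod.χ₄_nat_three_mod_four (by omega),
        jacobiSym.quadratic_reciprocity_three_mod_four (by omega) (by omega), hJp]
      norm_num
  obtain ⟨t, ht⟩ := exists_dvd_sq_add_of_jacobiSym hp hJ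
  have key : ∀ t : ℤ, (p : ℤ) ∣ t ^ 2 + d → t % 2 = 1 →
      ∃ x y z : ℤ, (N : ℤ) = x ^ 2 + y ^ 2 + z ^ 2 := by
    intro t ht ht2
    refine exists_sum_three_squares_of_dvd (d := d) (t := t) (by omega)
      (by exact_mod_cast hdodd.pos) ?_
    rw [← hpd]
    refine IsCoprime.mul_dvd ?_ ?_ ht
    · exact_mod_cast Nat.isCoprime_iff_coprime.2 (Nat.coprime_two_left.2 hpodd)
    · obtain ⟨e, he⟩ := hdodd
      obtain ⟨k, rfl⟩ : ∃ k, t = 2 * k + 1 := ⟨t / 2, by omega⟩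
      exact ⟨2 * k ^ 2 + 2 * k + 1 + e, by rw [he]; push_cast; ring⟩
  by_cases ht2 : t % 2 = 1
  · exact key t ht ht2
  -- Adding the odd p makes t odd, so that 2 ∣ t² + d as well.
  · refine key (t + p) ?_ (by have := Nat.odd_iff.1 hpodd; omega)
    obtain ⟨q, hq⟩ := ht
    exact ⟨q + 2 * t + p, by linear_combination hq⟩

/-- The Legendre–Gauss three-square theorem for integers not divisible by four. -/
theorem exists_sum_three_squares {N : ℕ} (h4 : N % 4 ≠ 0) (h7 : N % 8 ≠ 7) :
    ∃ x y z : ℤ, (N : ℤ) = x ^ 2 + y ^ 2 + z ^ 2 := by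
  by_cases h1 : N = 1
  · exact ⟨1, 0, 0, by simp [h1]⟩
  by_cases h2 : N % 4 = 2
  · exact exists_sum_three_squares_of_mod_four_eq_two h2
  by_cases h3 : N % 8 = 3
  · exact exists_sum_three_squares_of_odd (c := 1) (u := (N - 1) / 2) (by omega) (by omega)
      (by omega)
  · exact exists_sum_three_squares_of_odd (c := 3) (u := (3 * N - 1) / 2) (by omega) (by omega)
      (by omega)

/-! ### From three squares to four -/

/-- `n` is a sum of four squares of natural numbers `x, y, z, w` with `x + y - z = ± m`. -/
def FourSquaresWith (m : ℤ) (n : ℕ) : Prop :=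
  ∃ x y z w : ℕ, n = x ^ 2 + y ^ 2 + z ^ 2 + w ^ 2 ∧
    ((x : ℤ) + y - z = m ∨ (x : ℤ) + y - z = -m)

theorem FourSquaresWith.mul_sq {m : ℤ} {n : ℕ} (h : FourSquaresWith m n) (c : ℕ) :
    FourSquaresWith (c * m) (c ^ 2 * n) := by
  obtain ⟨x, y, z, w, rfl, h⟩ := h
  refine ⟨c * x, c * y, c * z, c * w, by ring, h.imp ?_ ?_⟩ <;>
  · intro h
    push_cast
    linear_combination (c : ℤ) * h

theorem FourSquaresWith.of_nonneg_nonpos {x y z w m : ℤ} {n : ℕ}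
    (hn : (n : ℤ) = x ^ 2 + y ^ 2 + z ^ 2 + w ^ 2) (hm : x + y + z = m ∨ x + y + z = -m)
    (hx : 0 ≤ x) (hy : 0 ≤ y) (hz : z ≤ 0) : FourSquaresWith m n := by
  refine ⟨x.natAbs, y.natAbs, z.natAbs, w.natAbs, ?_, by omega⟩
  zify
  simpa using hn

theorem FourSquaresWith.of_int {x y z w m : ℤ} {n : ℕ}
    (hn : (n : ℤ) = x ^ 2 + y ^ 2 + z ^ 2 + w ^ 2) (hm : x + y + z = m)
    (hS : m ^ 2 ≤ x ^ 2 + y ^ 2 + z ^ 2) : FourSquaresWith m n := by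
  have key : ∀ x y z : ℤ, (n : ℤ) = x ^ 2 + y ^ 2 + z ^ 2 + w ^ 2 →
      x + y + z = m ∨ x + y + z = -m → m ^ 2 ≤ x ^ 2 + y ^ 2 + z ^ 2 →
      0 ≤ x → 0 ≤ y → FourSquaresWith m n := by
    intro x y z hn hm hS hx hy
    rcases le_total z 0 with hz | hz
    · exact of_nonneg_nonpos hn hm hx hy hz
    have hm2 : (x + y + z) ^ 2 = m ^ 2 := by rcases hm with h | h <;> rw [h]; ring
    have hxy := mul_nonneg hx hy
    have hxz := mul_nonneg hx hz
    have hyz := mul_nonneg hy hz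
    -- `hS` says xy + yz + zx ≤ 0, so with no negative term some variable vanishes and can play the
    -- subtracted one.
    rcases mul_eq_zero.1 (show x * y = 0 by nlinarith) with h | h
    · exact of_nonneg_nonpos (x := y) (y := z) (z := x) (w := w) (by linarith) (by omega) hy hz h.le
    · exact of_nonneg_nonpos (x := x) (y := z) (z := y) (w := w) (by linarith) (by omega) hx hz h.le
  have key2 : ∀ x y z : ℤ, (n : ℤ) = x ^ 2 + y ^ 2 + z ^ 2 + w ^ 2 →
      x + y + z = m ∨ x + y + z = -m → m ^ 2 ≤ x ^ 2 + y ^ 2 + z ^ 2 →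
      0 ≤ x → FourSquaresWith m n := by
    intro x y z hn hm hS hx
    rcases le_total 0 y with hy | hy
    · exact key x y z hn hm hS hx hy
    rcases le_total 0 z with hz | hz
    · exact key x z y (by linarith) (by omega) (by linarith) hx hz
    exact of_nonneg_nonpos (x := -y) (y := -z) (z := -x) (w := w) (by rw [hn]; ring) (by omega)
      (by omega) (by omega) (by omega)
  rcases le_total 0 x with hx | hx
  · exact key2 x y z hn (.inl hm) hS hx
  · exact key2 (-x) (-y) (-z) (by rw [hn]; ring) (by omega) (by simpa using hS) (by omega)

/-- A representation of `3 n - m ^ 2` by three squares, with suitable residues modulo three, gives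
a four-square representation of `n` with a prescribed sum of three of the terms. -/
theorem FourSquaresWith.of_sum_three_squares {n : ℕ} {m A B C : ℤ}
    (h : 3 * (n : ℤ) - m ^ 2 = A ^ 2 + B ^ 2 + C ^ 2) (h3 : 3 ∣ A + B + C)
    (hm : 3 ∣ m + A - B) (hS : (A + B + C) ^ 2 ≤ 9 * ((n : ℤ) - m ^ 2)) :
    FourSquaresWith m n := by
  obtain ⟨w, hw⟩ := h3
  obtain ⟨x, hx⟩ := hm
  obtain ⟨y, hy⟩ : (3 : ℤ) ∣ m + B - C := by omega
  obtain ⟨z, hz⟩ : (3 : ℤ) ∣ m + C - A := by omega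
  have hn : (n : ℤ) = x ^ 2 + y ^ 2 + z ^ 2 + w ^ 2 := by
    have : 9 * (n : ℤ) = (3 * x) ^ 2 + (3 * y) ^ 2 + (3 * z) ^ 2 + (3 * w) ^ 2 := by
      rw [← hx, ← hy, ← hz, ← hw]
      linear_combination 3 * h
    linarith
  refine of_int hn (by omega) ?_
  rw [hw] at hS
  linarith

theorem Int.sq_emod_three (a : ℤ) : a % 3 = 0 ∧ a ^ 2 % 3 = 0 ∨
    (a % 3 = 1 ∨ a % 3 = 2) ∧ a ^ 2 % 3 = 1 := by
  have : a % 3 = 0 ∨ a % 3 = 1 ∨ a % 3 = 2 := by omega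
  rcases this with h | h | h <;> simp [pow_two, Int.mul_emod, h]

theorem fourSquaresWith_zero {n : ℕ} (h : ∃ A B C : ℤ, 3 * (n : ℤ) = A ^ 2 + B ^ 2 + C ^ 2) :
    FourSquaresWith 0 n := by
  obtain ⟨A, B, C, h⟩ := h
  have key : ∀ A B C : ℤ, 3 * (n : ℤ) = A ^ 2 + B ^ 2 + C ^ 2 → A % 3 = B % 3 → B % 3 = C % 3 →
      FourSquaresWith 0 n := by
    intro A B C h hAB hBC
    refine FourSquaresWith.of_sum_three_squares (A := A) (B := B) (C := C) (by linarith)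
      (by omega) (by omega) ?_
    nlinarith [sq_nonneg (A - B), sq_nonneg (B - C), sq_nonneg (C - A)]
  have hflip : ∀ a : ℤ, a ^ 2 % 3 = 1 → ∃ b : ℤ, b ^ 2 = a ^ 2 ∧ b % 3 = 1 := by
    intro a ha
    rcases Int.sq_emod_three a with h | ⟨h | h, -⟩
    · omega
    · exact ⟨a, rfl, h⟩
    · exact ⟨-a, by ring, by omega⟩
  by_cases hA : A ^ 2 % 3 = 1
  · obtain ⟨a, ha, ha1⟩ := hflip A hA
    obtain ⟨b, hb, hb1⟩ := hflip B (by have := B.sq_emod_three; have := C.sq_emod_three; omega)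
    obtain ⟨c, hc, hc1⟩ := hflip C (by have := B.sq_emod_three; have := C.sq_emod_three; omega)
    exact key a b c (by linarith) (by omega) (by omega)
  · have := A.sq_emod_three
    have := B.sq_emod_three
    have := C.sq_emod_three
    exact key A B C h (by omega) (by omega)

/-- Modulo 3 exactly one of A, B, C vanishes, say C, so its sign is free. The mean of (A+B±C)² is at
most 2(3n - m²), which `hn` bounds by 9(n - m²). -/
theorem fourSquaresWith_of_not_dvd {n : ℕ} {m : ℤ} (hm : ¬ 3 ∣ m) (hn : 7 * m ^ 2 ≤ 3 * (n : ℤ))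
    (h : ∃ A B C : ℤ, 3 * (n : ℤ) - m ^ 2 = A ^ 2 + B ^ 2 + C ^ 2) : FourSquaresWith m n := by
  have hm2 := m.sq_emod_three
  have key : ∀ A B C : ℤ, 3 * (n : ℤ) - m ^ 2 = A ^ 2 + B ^ 2 + C ^ 2 → 3 ∣ A + B + C →
      (A + B + C) ^ 2 ≤ 9 * ((n : ℤ) - m ^ 2) → FourSquaresWith m n := by
    intro A B C h hs hS
    have hA := A.sq_emod_three
    have hB := B.sq_emod_three
    have hC := C.sq_emod_three
    by_cases hAB : 3 ∣ m + A - B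
    · exact FourSquaresWith.of_sum_three_squares h hs hAB hS
    · exact FourSquaresWith.of_sum_three_squares (A := -A) (B := -B) (C := -C) (by linarith)
        (by omega) (by omega) (by linarith [show (-A + -B + -C) ^ 2 = (A + B + C) ^ 2 by ring])
  have key2 : ∀ A B C : ℤ, 3 * (n : ℤ) - m ^ 2 = A ^ 2 + B ^ 2 + C ^ 2 → 3 ∣ A + B → 3 ∣ C →
      FourSquaresWith m n := by
    intro A B C h hAB hC
    by_cases hS : (A + B + C) ^ 2 ≤ 9 * ((n : ℤ) - m ^ 2)
    · exact key A B C h (by omega) hS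
    · refine key A B (-C) (by linarith [neg_sq C]) (by omega) ?_
      nlinarith [sq_nonneg (A - B), sq_nonneg C]
  have key3 : ∀ A B C : ℤ, 3 * (n : ℤ) - m ^ 2 = A ^ 2 + B ^ 2 + C ^ 2 → 3 ∣ C →
      FourSquaresWith m n := by
    intro A B C h hC
    have hA := A.sq_emod_three
    have hB := B.sq_emod_three
    have hC' := C.sq_emod_three
    by_cases hAB : 3 ∣ A + B
    · exact key2 A B C h hAB hC
    · exact key2 A (-B) C (by linarith [neg_sq B]) (by omega) hC
  obtain ⟨A, B, C, h⟩ := h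
  have hA := A.sq_emod_three
  have hB := B.sq_emod_three
  have hC := C.sq_emod_three
  by_cases hC0 : 3 ∣ C
  · exact key3 A B C h hC0
  by_cases hB0 : 3 ∣ B
  · exact key3 A C B (by linarith) hB0
  · exact key3 C B A (by linarith) (by omega)

/-! ### Choice of m and descent -/

theorem exists_sum_three_squares_three_mul (n : ℕ) :
    (∃ A B C : ℤ, 3 * (n : ℤ) = A ^ 2 + B ^ 2 + C ^ 2) ∨ ∃ k l : ℕ, n = 4 ^ k * (8 * l + 5) := by
  induction n using Nat.strong_induction_on with
  | _ n ih =>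
    rcases Nat.eq_zero_or_pos n with rfl | hn
    · exact .inl ⟨0, 0, 0, by norm_num⟩
    by_cases h4 : n % 4 = 0
    · obtain ⟨q, rfl⟩ : ∃ q, n = 4 * q := ⟨n / 4, by omega⟩
      rcases ih q (by omega) with ⟨A, B, C, h⟩ | ⟨k, l, rfl⟩
      · exact .inl ⟨2 * A, 2 * B, 2 * C, by push_cast; linear_combination 4 * h⟩
      · exact .inr ⟨k + 1, l, by ring⟩
    · by_cases h5 : n % 8 = 5
      · exact .inr ⟨0, n / 8, by omega⟩
      · left
        simpa using exists_sum_three_squares (N := 3 * n) (by omega) (by omega)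

theorem fourSquaresWith_natCast {n m : ℕ} (hm : ¬ 3 ∣ m) (hn : 7 * m ^ 2 ≤ 3 * n)
    (h4 : (3 * n - m ^ 2) % 4 ≠ 0) (h7 : (3 * n - m ^ 2) % 8 ≠ 7) : FourSquaresWith m n := by
  refine fourSquaresWith_of_not_dvd (by omega) (by exact_mod_cast hn) ?_
  have := exists_sum_three_squares h4 h7
  rw [Nat.cast_sub (by omega)] at this
  simpa using this

theorem fourSquaresWith_two_mul_natCast {n m : ℕ} (hm : ¬ 3 ∣ m) (hn : 7 * (2 * m) ^ 2 ≤ 3 * (4 * n))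
    (h4 : (3 * n - m ^ 2) % 4 ≠ 0) (h7 : (3 * n - m ^ 2) % 8 ≠ 7) :
    FourSquaresWith (2 * m : ℕ) (4 * n) := by
  refine fourSquaresWith_of_not_dvd (by omega) (by exact_mod_cast hn) ?_
  obtain ⟨A, B, C, h⟩ := exists_sum_three_squares h4 h7
  rw [Nat.cast_sub (by nlinarith)] at h
  push_cast at h ⊢
  exact ⟨2 * A, 2 * B, 2 * C, by linear_combination 4 * h⟩

theorem exists_fourSquaresWith_four_pow {n : ℕ} (hn : 1 ≤ n) :
    ∃ k : ℕ, FourSquaresWith (4 ^ k) n := by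
  induction n using Nat.strong_induction_on with
  | _ n ih =>
    by_cases h16 : n % 16 = 0
    · obtain ⟨q, rfl⟩ : ∃ q, n = 16 * q := ⟨n / 16, by omega⟩
      obtain ⟨k, h⟩ := ih q (by omega) (by omega)
      exact ⟨k + 1, by simpa [pow_succ'] using h.mul_sq 4⟩
    by_cases h1 : n % 4 ≠ 3 ∧ n % 8 ≠ 0
    · refine ⟨0, ?_⟩
      by_cases hn3 : 3 ≤ n
      · simpa using fourSquaresWith_natCast (n := n) (m := 1) (by omega) (by omega) (by omega)
          (by omega)
      · obtain rfl | rfl : n = 1 ∨ n = 2 := by omega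
        · exact ⟨1, 0, 0, 0, by norm_num⟩
        · exact ⟨1, 0, 0, 1, by norm_num⟩
    -- Here 3n - 1 is 0 mod 4 or 7 mod 8, so m = 4 is used; it needs 7·16 ≤ 3n.
    by_cases hlarge : 38 ≤ n
    · refine ⟨1, ?_⟩
      by_cases h3 : n % 4 = 3
      · simpa using fourSquaresWith_natCast (n := n) (m := 4) (by omega) (by omega) (by omega)
          (by omega)
      · obtain ⟨q, rfl⟩ : ∃ q, n = 4 * q := ⟨n / 4, by omega⟩
        simpa using fourSquaresWith_two_mul_natCast (n := q) (m := 2) (by omega) (by omega)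
          (by omega) (by omega)
    clear ih
    obtain rfl | rfl | rfl | rfl | rfl | rfl | rfl | rfl | rfl | rfl | rfl :
        n = 3 ∨ n = 7 ∨ n = 8 ∨ n = 11 ∨ n = 15 ∨ n = 19 ∨ n = 23 ∨ n = 24 ∨ n = 27 ∨ n = 31 ∨
          n = 35 := by omega
    · exact ⟨0, 1, 1, 1, 0, by norm_num⟩
    · exact ⟨0, 1, 1, 1, 2, by norm_num⟩
    · exact ⟨1, 2, 2, 0, 0, by norm_num⟩
    · exact ⟨0, 1, 1, 3, 0, by norm_num⟩
    · exact ⟨0, 1, 1, 3, 2, by norm_num⟩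
    · exact ⟨0, 1, 1, 1, 4, by norm_num⟩
    · exact ⟨0, 1, 3, 3, 2, by norm_num⟩
    · exact ⟨1, 2, 2, 0, 4, by norm_num⟩
    · exact ⟨0, 1, 1, 3, 4, by norm_num⟩
    · exact ⟨1, 1, 5, 2, 1, by norm_num⟩
    · exact ⟨0, 1, 3, 3, 4, by norm_num⟩

theorem exists_fourSquaresWith_eight_pow {a : ℕ} (ha : a = 1 ∨ a = 2) (n : ℕ) :
    FourSquaresWith 0 n ∨ ∃ k : ℕ, FourSquaresWith (a * 8 ^ k) n := by
  induction n using Nat.strong_induction_on with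
  | _ n ih =>
    rcases exists_sum_three_squares_three_mul n with h | ⟨k, l, rfl⟩
    · exact .inl (fourSquaresWith_zero h)
    match k, ih with
    | k + 3, ih =>
      have hq : 4 ^ (k + 3) * (8 * l + 5) = 8 ^ 2 * (4 ^ k * (8 * l + 5)) := by ring
      rw [hq] at ih ⊢
      have hpos : 0 < 4 ^ k * (8 * l + 5) := by positivity
      rcases ih (4 ^ k * (8 * l + 5)) (by omega) with h | ⟨j, h⟩
      · exact .inl (by simpa using h.mul_sq 8)
      · refine .inr ⟨j + 1, ?_⟩
        have := h.mul_sq 8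
        rwa [show ((8 : ℕ) : ℤ) * (a * 8 ^ j) = a * 8 ^ (j + 1) by push_cast; ring] at this
    | 0, _ =>
      refine .inr ⟨0, ?_⟩
      rw [pow_zero, pow_zero, one_mul, mul_one]
      by_cases h0 : a = 2 ∧ l = 0
      · obtain ⟨rfl, rfl⟩ := h0
        exact ⟨2, 0, 0, 1, by norm_num⟩
      · rcases ha with rfl | rfl <;>
          exact fourSquaresWith_natCast (by omega) (by omega) (by omega) (by omega)
    | 1, _ =>
      refine .inr ⟨0, ?_⟩
      rw [pow_one, pow_zero, mul_one]
      rcases ha with rfl | rfl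
      · exact fourSquaresWith_natCast (by omega) (by omega) (by omega) (by omega)
      · simpa using fourSquaresWith_two_mul_natCast (n := 8 * l + 5) (m := 1) (by omega) (by omega)
          (by omega) (by omega)
    | 2, _ =>
      rcases ha with rfl | rfl
      -- 3n - 1 ≡ 7 mod 8, whereas m = 8 gives 3n - 64 = 16(24l + 11); the size bound fails only at
      -- l = 0.
      · refine .inr ⟨1, ?_⟩
        rcases Nat.eq_zero_or_pos l with rfl | hl
        · exact ⟨8, 0, 0, 4, by norm_num⟩
        refine fourSquaresWith_of_not_dvd (by norm_num) (by push_cast; omega) ?_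
        obtain ⟨A, B, C, h⟩ := exists_sum_three_squares (N := 24 * l + 11) (by omega) (by omega)
        refine ⟨4 * A, 4 * B, 4 * C, ?_⟩
        push_cast at h ⊢
        linear_combination 16 * h
      · refine .inr ⟨0, ?_⟩
        rw [show 4 ^ 2 * (8 * l + 5) = 4 * (32 * l + 20) by ring]
        simpa using fourSquaresWith_two_mul_natCast (n := 32 * l + 20) (m := 1) (by omega)
          (by omega) (by omega) (by omega)

theorem theorem1p3 :
    (∀ n : ℕ, 1 ≤ n → ∃ x y z w : ℕ,
      n = x ^ 2 + y ^ 2 + z ^ 2 + w ^ 2 ∧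
      |(x : ℤ) + (y : ℤ) - (z : ℤ)| ∈ {m : ℤ | ∃ k : ℕ, m = 4 ^ k}) ∧
    (∀ a : ℤ, a = 1 ∨ a = 2 →
      (∀ n : ℕ, ∃ x y z w : ℕ,
        n = x ^ 2 + y ^ 2 + z ^ 2 + w ^ 2 ∧
        (x : ℤ) + (y : ℤ) - (z : ℤ) ∈
          {m : ℤ | ∃ k : ℕ, m = a * 8 ^ k ∨ m = -(a * 8 ^ k)} ∪ {0}) ∧
      {m : ℤ | ∃ k : ℕ, m = a * 8 ^ k ∨ m = -(a * 8 ^ k)} ∪ {0} ⊆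
        {m : ℤ | ∃ t : ℤ, m = a * t ^ 3}) := by
  refine ⟨fun n hn => ?_, fun a ha => ⟨fun n => ?_, ?_⟩⟩
  · obtain ⟨k, x, y, z, w, h, hm⟩ := exists_fourSquaresWith_four_pow hn
    refine ⟨x, y, z, w, h, k, ?_⟩
    rcases hm with hm | hm <;> simp [hm]
  · obtain ⟨b, hb, rfl⟩ : ∃ b : ℕ, (b = 1 ∨ b = 2) ∧ a = b := ⟨a.toNat, by omega, by omega⟩
    rcases exists_fourSquaresWith_eight_pow hb n with ⟨x, y, z, w, h, hm⟩ | ⟨k, x, y, z, w, h, hm⟩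
    · exact ⟨x, y, z, w, h, .inr (by simpa using hm)⟩
    · exact ⟨x, y, z, w, h, .inl ⟨k, hm⟩⟩
  · have h8 : ∀ k : ℕ, (8 : ℤ) ^ k = (2 ^ k) ^ 3 := fun k => by
      rw [← pow_mul, mul_comm, pow_mul]; norm_num
    rintro m (⟨k, rfl | rfl⟩ | rfl)
    · exact ⟨2 ^ k, by rw [h8]⟩
    · exact ⟨-2 ^ k, by rw [h8]; ring⟩
    · exact ⟨0, by ring⟩
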